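/- Let $\Re=\mathbb{Z}_4+v\mathbb{Z}_4$ with $v^2=v$, and let $n\ge 1$ be odd. A linear code of length $n$ over $\Re$ is an $\Re$-submodule $C$ of $\Re^n$; it is cyclic if it is closed under $(c_0,\dots,c_{n-1})\mapsto(c_{n-1},c_0,\dots,c_{n-2})$. Its dual is $C^{\perp}=\{h\in\Re^n : \sum_i h_ik_i=0 \text{ for all } k\in C\}$, and its hull is $\mathrm{Hull}(C)=C\cap C^{\perp}$. A code is of type $4^{k_1}2^{k_2}$ if it is isomorphic, as an abelian group, to $\mathbb{Z}_4^{k_1}\times\mathbb{Z}_2^{k_2}$. Let $N_2$ be the set of integers $l\ge 1$ that divide $2^i+1$ for some integer $i\ge 1$, let $\mathrm{ord}_j(2)$ be the multiplicative order of $2$ modulo $j$ (so $\mathrm{ord}_1(2)=1$), and put $\gamma(j)=\varphi(j)/\mathrm{ord}_j(2)$ for $j\mid n$, $j\in N_2$, and $\beta(j)=\varphi(j)/(2\,\mathrm{ord}_j(2))$ for $j\mid n$, $j\notin N_2$, where $\varphi$ is Euler's totient function. **Theorem 4.2.** The hull of every cyclic code of length $n$ over $\Re$ is of type $4^{k_1}2^{k_2}$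 for some integers $k_1,k_2\ge 0$. For integers $k_1,k_2\ge 0$ there is a cyclic code of length $n$ over $\Re$ whose hull is of type $4^{k_1}2^{k_2}$ if and only if $$k_1=\sum_{j\mid n,\ j\notin N_2}\mathrm{ord}_j(2)\,(a_{1j}+a_{2j}),\qquad k_2=\sum_{j\mid n,\ j\in N_2}\mathrm{ord}_j(2)\,(b_{1j}+b_{2j})+\sum_{j\mid n,\ j\notin N_2}\mathrm{ord}_j(2)\,(c_{1j}+c_{2j})$$ for some integers $a_{ij},b_{ij},c_{ij}$ ($i=1,2$) such that $0\le b_{ij}\le\gamma(j)$ for all $j\mid n$ with $j\in N_2$, and $0\le a_{ij}\le\beta(j)$ and $0\le c_{ij}\le 2(\beta(j)-a_{ij})$ for all $j\mid n$ with $j\notin N_2$. -/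

import Mathlib

namespace HullTypes

/-- The ring `ℤ₄ + vℤ₄` with `v² = v`: its elements are the `a + b v` with `a b : ℤ₄`, where
`v = ⟨0, 1⟩` satisfies `v² = 0 + 1 · v`. -/
abbrev Z4v : Type := QuadraticAlgebra (ZMod 4) 0 1

/-- A linear code of length `n` is an `Z4v`-submodule of `Z4v ^ n`. -/
abbrev LinearCode (n : ℕ) : Type := Submodule Z4v (Fin n → Z4v)

variable {n : ℕ}

/-- The cyclic shift `(c₀, c₁, …, cₙ₋₁) ↦ (cₙ₋₁, c₀, …, cₙ₋₂)`. -/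
def cyclicShift (c : Fin n → Z4v) : Fin n → Z4v := fun i => c ((finRotate n).symm i)

/-- A linear code is cyclic if it is closed under the cyclic shift. -/
def IsCyclicCode (C : LinearCode n) : Prop := ∀ c ∈ C, cyclicShift c ∈ C

/-- The dual code with respect to `h · k = h₀ k₀ + ⋯ + hₙ₋₁ kₙ₋₁`. -/
def dual (C : LinearCode n) : LinearCode n where
  carrier := {h | ∀ k ∈ C, ∑ i, h i * k i = 0}
  zero_mem' := by
    intro k _
    simp
  add_mem' := by
    intro x y hx hy k hk
    simp only [Pi.add_apply, add_mul, Finset.sum_add_distrib]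
    rw [hx k hk, hy k hk, add_zero]
  smul_mem' := by
    intro r x hx k hk
    simp only [Pi.smul_apply, smul_eq_mul, mul_assoc]
    rw [← Finset.mul_sum, hx k hk, mul_zero]

/-- The hull of a code: its intersection with its dual. -/
def hull (C : LinearCode n) : LinearCode n := C ⊓ dual C

/-- A code is of type `4 ^ k₁ 2 ^ k₂` if, as an abelian group (equivalently, as a `ℤ₄`-module), it
is isomorphic to `ℤ₄ ^ k₁ × ℤ₂ ^ k₂`. -/
def HasType (C : LinearCode n) (k₁ k₂ : ℕ) : Prop :=
  Nonempty (C ≃+ ((Fin k₁ → ZMod 4) × (Fin k₂ → ZMod 2)))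

/-- The set of the `l ≥ 1` that divide `2 ^ i + 1` for some positive integer `i`. -/
def N₂ : Set ℕ := {l | 1 ≤ l ∧ ∃ i : ℕ, 1 ≤ i ∧ l ∣ 2 ^ i + 1}

noncomputable instance decidableMemN₂ (j : ℕ) : Decidable (j ∈ N₂) := Classical.dec _

/-- The multiplicative order of `2` modulo `j` (used for odd `j`; it is `1` for `j = 1`). -/
noncomputable def ord (j : ℕ) : ℕ := orderOf (2 : ZMod j)

/-- `γ(j) = φ(j) / ord_j(2)`; the division is exact for odd `j`. -/
noncomputable def γ (j : ℕ) : ℕ := Nat.totient j / ord j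

/-- `β(j) = φ(j) / (2 ord_j(2))`; the division is exact for odd `j ∉ N₂`. -/
noncomputable def β (j : ℕ) : ℕ := Nat.totient j / (2 * ord j)

end HullTypes

namespace HullTypes

/-! ### Finite abelian groups of exponent dividing 4 -/

section GroupType

variable {H : Type*} [AddCommGroup H]

/-! Evaluating `v` at 0 and at 1 splits the ring as `ℤ₄ × ℤ₄`, so a cyclic code is an arbitrary pair
of ideals of `ℤ₄[ℤ/n]`. Multiplying by the reversal of a vector turns orthogonality into
annihilation, so the hull of the code is the product of the hulls `D ∩ σ⁻¹(Ann D)` of its two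
components (`nonempty_hull_addEquiv`). The type of a group killed by 4 is read off from its order
and the order of its 2-torsion, so types add over the two components.

For one ideal `D`, let `P` be its reduction modulo 2 and `Q ⊇ P` its torsion ideal, the classes of
`u` with `2u ∈ D`. Then `|D| = |P||Q|`, and the 2-torsion of `D` has `|Q|` elements. The hull has
reduction `P ∩ τ⁻¹(Ann Q)` and torsion `Q ∩ τ⁻¹(Ann P)` (`IsResidueMap.map_idealHull`,
`IsResidueMap.torsionIdeal_idealHull`), and every pair `P ≤ Q` with `P` principal occurs
(`IsResidueMap.exists_ideal`).

Since `n` is odd, the Fourier transform identifies ideals of `𝔽₂[ℤ/n]` with sets of 2-cyclotomic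
cosets: annihilators become complements and reversal becomes negation. If `p ⊆ q` are the sets of
`P` and `Q`, the hull is governed by `p ∩ -qᶜ` and `q ∩ -pᶜ`. Counting these sets among the cosets
of each additive order `j` gives the bounds: negation fixes every such coset if `j ∈ N₂`, and pairs
them without fixed points otherwise. -/

theorem exists_addEquiv_pi_zmod {ι : Type} [Fintype ι] (e : ι → ℕ) (he : ∀ i, e i = 4 ∨ e i = 2) :
    ∃ k₁ k₂ : ℕ,
      Nonempty ((∀ i, ZMod (e i)) ≃+ ((Fin k₁ → ZMod 4) × (Fin k₂ → ZMod 2))) := by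
  classical
  let e₁ := Fintype.equivFin {i // e i = 4}
  let e₂ := Fintype.equivFin {i // ¬ e i = 4}
  have h2 : ∀ i : {i // ¬ e i = 4}, e i = 2 := fun i => (he i).resolve_left i.2
  refine ⟨Fintype.card {i // e i = 4}, Fintype.card {i // ¬ e i = 4}, ⟨?_⟩⟩
  refine ({ Equiv.piEquivPiSubtypeProd (fun i => e i = 4) (fun i => ZMod (e i)) with
    map_add' := fun x y => rfl } : _ ≃+ _).trans (AddEquiv.prodCongr ?_ ?_)
  · exact (AddEquiv.piCongrRight fun i : {i // e i = 4} =>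
      (ZMod.ringEquivCongr i.2).toAddEquiv).trans (AddEquiv.arrowCongr e₁ (AddEquiv.refl _))
  · exact (AddEquiv.piCongrRight fun i : {i // ¬ e i = 4} =>
      (ZMod.ringEquivCongr (h2 i)).toAddEquiv).trans (AddEquiv.arrowCongr e₂ (AddEquiv.refl _))

theorem exists_addEquiv_of_four_nsmul [Finite H] (h4 : ∀ x : H, 4 • x = 0) :
    ∃ k₁ k₂ : ℕ, Nonempty (H ≃+ ((Fin k₁ → ZMod 4) × (Fin k₂ → ZMod 2))) := by
  classical
  obtain ⟨ι, _, e, he, ⟨f⟩⟩ := AddCommGroup.equiv_directSum_zmod_of_finite' H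
  let g : H ≃+ ∀ i, ZMod (e i) := f.trans (DirectSum.addEquivProd _)
  have hdvd : ∀ i, e i ∣ 4 := by
    intro i
    have h := h4 (g.symm (Pi.single i 1))
    rw [← map_nsmul, AddEquiv.map_eq_zero_iff] at h
    have h' := congrFun h i
    simp only [Pi.smul_apply, Pi.single_eq_same, Pi.zero_apply, nsmul_eq_mul, mul_one] at h'
    exact (ZMod.natCast_eq_zero_iff _ _).1 h'
  obtain ⟨k₁, k₂, ⟨h⟩⟩ := exists_addEquiv_pi_zmod e (fun i => by
    have h1 := he i
    have h2 := hdvd i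
    have h3 := Nat.le_of_dvd (by norm_num) h2
    interval_cases (e i) <;> simp_all)
  exact ⟨k₁, k₂, ⟨g.trans h⟩⟩

theorem card_two_torsion_congr {H' : Type*} [AddCommGroup H'] (f : H ≃+ H') :
    Nat.card {x : H // 2 • x = 0} = Nat.card {x : H' // 2 • x = 0} :=
  Nat.card_congr (f.toEquiv.subtypeEquiv fun x => by
    rw [AddEquiv.toEquiv_eq_coe, EquivLike.coe_coe, ← map_nsmul, AddEquiv.map_eq_zero_iff])

theorem card_two_torsion_prod {H' : Type*} [AddCommGroup H'] :
    Nat.card {x : H × H' // 2 • x = 0} =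
      Nat.card {x : H // 2 • x = 0} * Nat.card {x : H' // 2 • x = 0} := by
  rw [← Nat.card_prod]
  refine Nat.card_congr ((Equiv.subtypeEquivRight fun x => ?_).trans
    (Equiv.subtypeProdEquivProd (p := fun x : H => 2 • x = 0) (q := fun x : H' => 2 • x = 0)))
  simp [Prod.ext_iff]

theorem card_two_torsion_pi (k : ℕ) :
    Nat.card {x : Fin k → H // 2 • x = 0} = Nat.card {x : H // 2 • x = 0} ^ k := by
  have h := Nat.card_congr (Equiv.subtypePiEquivPi (p := fun (_ : Fin k) (x : H) => 2 • x = 0))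
  rw [Nat.card_pi, Finset.prod_const, Finset.card_fin] at h
  rw [← h]
  exact Nat.card_congr (Equiv.subtypeEquivRight fun x => by simp only [funext_iff]; rfl)

theorem card_two_torsion_model (k₁ k₂ : ℕ) :
    Nat.card {x : (Fin k₁ → ZMod 4) × (Fin k₂ → ZMod 2) // 2 • x = 0} = 2 ^ (k₁ + k₂) := by
  have h4 : Nat.card {x : ZMod 4 // 2 • x = 0} = 2 := by
    rw [Nat.card_eq_fintype_card]; decide
  have h2 : Nat.card {x : ZMod 2 // 2 • x = 0} = 2 := by
    rw [Nat.card_eq_fintype_card]; decide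
  rw [card_two_torsion_prod, card_two_torsion_pi, card_two_torsion_pi, h4, h2, pow_add]

/-- A finite abelian group of exponent dividing `4` is determined by its order and by the order of
its `2`-torsion. -/
theorem nonempty_addEquiv_iff [Finite H] (h4 : ∀ x : H, 4 • x = 0) (k₁ k₂ : ℕ) :
    Nonempty (H ≃+ ((Fin k₁ → ZMod 4) × (Fin k₂ → ZMod 2))) ↔
      Nat.card H = 2 ^ (2 * k₁ + k₂) ∧ Nat.card {x : H // 2 • x = 0} = 2 ^ (k₁ + k₂) := by
  have key : ∀ l₁ l₂ : ℕ, Nonempty (H ≃+ ((Fin l₁ → ZMod 4) × (Fin l₂ → ZMod 2))) →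
      Nat.card H = 2 ^ (2 * l₁ + l₂) ∧ Nat.card {x : H // 2 • x = 0} = 2 ^ (l₁ + l₂) := by
    rintro l₁ l₂ ⟨f⟩
    refine ⟨?_, (card_two_torsion_congr f).trans (card_two_torsion_model l₁ l₂)⟩
    rw [Nat.card_congr f.toEquiv, Nat.card_prod]
    simp [pow_add, pow_mul]
  refine ⟨key k₁ k₂, fun ⟨h1, h2⟩ => ?_⟩
  obtain ⟨l₁, l₂, h⟩ := exists_addEquiv_of_four_nsmul h4
  obtain ⟨h3, h5⟩ := key l₁ l₂ h
  have e1 := Nat.pow_right_injective le_rfl (h1.symm.trans h3)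
  have e2 := Nat.pow_right_injective le_rfl (h2.symm.trans h5)
  obtain rfl : k₁ = l₁ := by omega
  obtain rfl : k₂ = l₂ := by omega
  exact h

end GroupType

/-- Both images are quotients of `K` by the same subgroup. Used to compare multiplication by 2 with
reduction modulo 2. -/
theorem card_map_eq_of_ker {S A B : Type*} [AddCommGroup S] [AddCommGroup A] [AddCommGroup B]
    (K : AddSubgroup S) (f : S →+ A) (g : S →+ B) (h : ∀ s, f s = 0 ↔ g s = 0) :
    Nat.card (K.map f) = Nat.card (K.map g) := by
  have hk : (f.comp K.subtype).ker = (g.comp K.subtype).ker := by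
    ext x
    simpa [AddMonoidHom.mem_ker] using h x
  have e1 := Nat.card_congr (QuotientAddGroup.quotientKerEquivRange (f.comp K.subtype)).toEquiv
  have e2 := Nat.card_congr (QuotientAddGroup.quotientKerEquivRange (g.comp K.subtype)).toEquiv
  rw [AddMonoidHom.range_comp, AddSubgroup.range_subtype] at e1 e2
  rw [← e1, ← e2, hk]

/-! ### Residue and torsion ideals, and the hull of an ideal -/

section Residue

variable {S A : Type*} [CommRing S] [CommRing A]

/-- The hull of an ideal `D` with respect to an involution `σ`. -/
def idealHull (σ : S ≃+* S) (D : Ideal S) : Ideal S :=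
  D ⊓ (Submodule.annihilator D).comap (σ : S →+* S)

theorem mem_idealHull {σ : S ≃+* S} {D : Ideal S} {h : S} :
    h ∈ idealHull σ D ↔ h ∈ D ∧ ∀ d ∈ D, σ h * d = 0 := by
  simp [idealHull, Submodule.mem_annihilator]

/-- The ideal of all `π u` with `2 * u ∈ D`. -/
def torsionIdeal (π : S →+* A) (D : Ideal S) : Ideal A :=
  Ideal.map π (Submodule.comap (LinearMap.mulLeft S (2 : S)) D)

/-- A surjection `π : S → A` that behaves like the reduction modulo `2` of a free `ℤ₄`-algebra whose
reduction satisfies the identity `x ^ m = x`. -/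
structure IsResidueMap (π : S →+* A) (m : ℕ) : Prop where
  surjective : Function.Surjective π
  eq_zero_iff : ∀ s, π s = 0 ↔ ∃ t, s = 2 * t
  two_mul_eq_zero : ∀ s, 2 * s = 0 ↔ π s = 0
  two_le : 2 ≤ m
  pow_eq : ∀ x : A, x ^ m = x

variable {π : S →+* A} {m : ℕ} (hπ : IsResidueMap π m)
include hπ

theorem IsResidueMap.map_two_mul (s : S) : π (2 * s) = 0 := (hπ.eq_zero_iff _).2 ⟨s, rfl⟩

theorem IsResidueMap.four_mul (s : S) : 2 * (2 * s) = 0 :=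
  (hπ.two_mul_eq_zero _).2 (hπ.map_two_mul s)

theorem IsResidueMap.two_mul_congr {s t : S} (h : π s = π t) : 2 * s = 2 * t := by
  rw [← sub_eq_zero, ← mul_sub, hπ.two_mul_eq_zero, map_sub, h, sub_self]

theorem IsResidueMap.mem_torsionIdeal {D : Ideal S} {u : S} :
    π u ∈ torsionIdeal π D ↔ 2 * u ∈ D := by
  rw [torsionIdeal, Ideal.mem_map_iff_of_surjective π hπ.surjective]
  constructor
  · rintro ⟨u', h, h'⟩
    rw [← hπ.two_mul_congr h']
    simpa using h
  · intro h
    exact ⟨u, by simpa using h, rfl⟩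

theorem IsResidueMap.map_le_torsionIdeal (D : Ideal S) : D.map π ≤ torsionIdeal π D := by
  intro x hx
  obtain ⟨d, hd, rfl⟩ := (Ideal.mem_map_iff_of_surjective π hπ.surjective).1 hx
  exact hπ.mem_torsionIdeal.2 (D.mul_mem_left _ hd)

variable {σ : S ≃+* S} {τ : A ≃+* A} (hσ : ∀ s, π (σ s) = τ (π s))
include hσ

theorem IsResidueMap.map_idealHull (D : Ideal S) :
    (idealHull σ D).map π =
      D.map π ⊓ (Submodule.annihilator (torsionIdeal π D)).comap (τ : A →+* A) := by
  have hmap := fun (I : Ideal S) (x : A) =>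
    Ideal.mem_map_iff_of_surjective (I := I) (y := x) π hπ.surjective
  obtain ⟨l, rfl⟩ : ∃ l, m = l + 2 := ⟨m - 2, by have := hπ.two_le; omega⟩
  ext x
  simp only [hmap, Ideal.mem_inf, Ideal.mem_comap, Submodule.mem_annihilator, smul_eq_mul,
    mem_idealHull, RingHom.coe_coe]
  constructor
  · rintro ⟨h, ⟨hD, ha⟩, rfl⟩
    refine ⟨⟨h, hD, rfl⟩, fun y hy => ?_⟩
    obtain ⟨u, rfl⟩ := hπ.surjective y
    have h0 := ha _ (hπ.mem_torsionIdeal.1 hy)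
    rw [← hσ, ← map_mul, ← hπ.two_mul_eq_zero, ← h0]
    ring
  · rintro ⟨⟨d, hd, rfl⟩, ha⟩
    -- The lift `d` itself may fail to lie in the hull, but `d ^ m` has the same reduction. For `c ∈
    -- D`, `σ d * c` is some `2 * s` with `π s` in the torsion ideal, so a second factor `σ d` kills
    -- it; `2 ≤ m` provides that factor.
    refine ⟨d ^ (l + 2), ⟨?_, fun c hc => ?_⟩, ?_⟩
    · exact D.pow_mem_of_mem hd _ (by omega)
    · have h1 : π (σ d * c) = 0 := by
        rw [map_mul, hσ]
        exact ha _ (hπ.map_le_torsionIdeal D (Ideal.mem_map_of_mem π hc))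
      obtain ⟨s, hs⟩ := (hπ.eq_zero_iff _).1 h1
      have h2 : π s ∈ torsionIdeal π D :=
        hπ.mem_torsionIdeal.2 (hs ▸ D.mul_mem_left _ hc)
      have h3 := ha _ h2
      rw [← hσ, ← map_mul, ← hπ.two_mul_eq_zero] at h3
      calc σ (d ^ (l + 2)) * c = σ d ^ l * (σ d * (σ d * c)) := by rw [map_pow]; ring
        _ = σ d ^ l * (2 * (σ d * s)) := by rw [hs]; ring
        _ = 0 := by rw [h3, mul_zero]
    · rw [map_pow, hπ.pow_eq]

theorem IsResidueMap.torsionIdeal_idealHull (D : Ideal S) :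
    torsionIdeal π (idealHull σ D) =
      torsionIdeal π D ⊓ (Submodule.annihilator (D.map π)).comap (τ : A →+* A) := by
  ext x
  obtain ⟨u, rfl⟩ := hπ.surjective x
  simp only [hπ.mem_torsionIdeal, Ideal.mem_inf, Ideal.mem_comap, Submodule.mem_annihilator,
    smul_eq_mul, mem_idealHull, RingHom.coe_coe]
  refine and_congr_right fun _ => ?_
  have key : ∀ d, σ (2 * u) * d = 0 ↔ τ (π u) * π d = 0 := by
    intro d
    rw [map_mul, map_ofNat, mul_assoc, hπ.two_mul_eq_zero, map_mul, hσ]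
  constructor
  · intro h y hy
    obtain ⟨d, hd, rfl⟩ := (Ideal.mem_map_iff_of_surjective π hπ.surjective).1 hy
    exact (key d).1 (h d hd)
  · intro h d hd
    exact (key d).2 (h _ (Ideal.mem_map_of_mem π hd))

omit hσ

theorem IsResidueMap.card_two_torsion (D : Ideal S) :
    Nat.card {x : D // 2 • x = 0} = Nat.card (torsionIdeal π D) := by
  let K : AddSubgroup S :=
    (Submodule.comap (LinearMap.mulLeft S (2 : S)) D : Ideal S).toAddSubgroup
  -- On `K = {u | 2u ∈ D}`, doubling has the 2-torsion of `D` as image, while `π` has the torsion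
  -- ideal.
  have h := card_map_eq_of_ker K (AddMonoidHom.mulLeft (2 : S)) π.toAddMonoidHom
    (fun s => hπ.two_mul_eq_zero s)
  have e1 : Nat.card {x : D // 2 • x = 0} = Nat.card (K.map (AddMonoidHom.mulLeft (2 : S))) := by
    refine Nat.card_congr
      ⟨fun x => ⟨x.1.1, ?_⟩, fun y => ⟨⟨y.1, ?_⟩, ?_⟩, fun x => rfl, fun y => rfl⟩
    · have h0 : 2 * (x.1 : S) = 0 := by
        have := congrArg Subtype.val x.2
        simpa [two_mul, two_nsmul] using this
      obtain ⟨t, ht⟩ := (hπ.eq_zero_iff _).1 ((hπ.two_mul_eq_zero _).1 h0)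
      refine ⟨t, ?_, ht.symm⟩
      have := x.1.2
      rw [ht] at this
      exact this
    · obtain ⟨t, ht, h'⟩ := y.2
      rw [← h']
      exact ht
    · obtain ⟨t, ht, h'⟩ := y.2
      apply Subtype.ext
      have h2 : 2 • (2 * t) = 0 := by rw [nsmul_eq_mul, Nat.cast_ofNat, hπ.four_mul]
      simpa [← h'] using h2
  have e2 : Nat.card (K.map π.toAddMonoidHom) = Nat.card (torsionIdeal π D) := by
    refine Nat.card_congr (Equiv.subtypeEquivRight fun x => ?_)
    rw [torsionIdeal, Ideal.mem_map_iff_of_surjective π hπ.surjective]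
    rfl
  rw [e1, h, e2]

/-- The kernel of `π` on `D` is exactly the 2-torsion of `D`. -/
theorem IsResidueMap.card_ideal (D : Ideal S) :
    Nat.card D = Nat.card (D.map π) * Nat.card (torsionIdeal π D) := by
  let f : D →+ A := π.toAddMonoidHom.comp D.toAddSubgroup.subtype
  have h1 := AddSubgroup.card_eq_card_quotient_mul_card_addSubgroup f.ker
  have h2 := Nat.card_congr (QuotientAddGroup.quotientKerEquivRange f).toEquiv
  have e1 : Nat.card f.range = Nat.card (D.map π) := by
    refine Nat.card_congr (Equiv.subtypeEquivRight fun x => ?_)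
    rw [Ideal.mem_map_iff_of_surjective π hπ.surjective]
    constructor
    · rintro ⟨d, hd⟩
      exact ⟨d.1, d.2, hd⟩
    · rintro ⟨d, hd, h⟩
      exact ⟨⟨d, hd⟩, h⟩
  have e2 : Nat.card f.ker = Nat.card {x : D // 2 • x = 0} := by
    refine Nat.card_congr (Equiv.subtypeEquivRight fun x => ?_)
    rw [Subtype.ext_iff]
    change π x.1 = 0 ↔ 2 • x.1 = 0
    rw [← hπ.two_mul_eq_zero, nsmul_eq_mul, Nat.cast_ofNat]
  rw [h1, h2, e1, e2, hπ.card_two_torsion]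

/-- Every principal ideal is the residue, and every larger ideal the torsion, of some ideal. -/
theorem IsResidueMap.exists_ideal {P Q : Ideal A} (hP : P.IsPrincipal) (hPQ : P ≤ Q) :
    ∃ D : Ideal S, D.map π = P ∧ torsionIdeal π D = Q := by
  obtain ⟨p, hp⟩ := hP
  obtain ⟨l, rfl⟩ : ∃ l, m = l + 2 := ⟨m - 2, by have := hπ.two_le; omega⟩
  obtain ⟨f, rfl⟩ := hπ.surjective p
  -- The square keeps the torsion from exceeding `Q`. If `f ^ 2 * s` reduces to 0, so does `f * s`
  -- by `x ^ m = x`; hence `f * s = 2 * t` and `f ^ 2 * s = 2 * (f * t)` with `π (f * t) ∈ P ≤ Q`.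
  -- An arbitrary lift `f` would give no such control.
  let D : Ideal S := Ideal.span {f ^ 2} ⊔ Submodule.map (LinearMap.mulLeft S (2 : S)) (Ideal.comap π Q)
  have hD : ∀ x, x ∈ D ↔ ∃ s q, π q ∈ Q ∧ x = f ^ 2 * s + 2 * q := by
    intro x
    simp only [D, Submodule.mem_sup, Ideal.mem_span_singleton', Submodule.mem_map, Ideal.mem_comap]
    constructor
    · rintro ⟨_, ⟨s, rfl⟩, _, ⟨q, hq, rfl⟩, rfl⟩
      exact ⟨s, q, hq, by rw [mul_comm s]; rfl⟩
    · rintro ⟨s, q, hq, rfl⟩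
      exact ⟨_, ⟨s, rfl⟩, _, ⟨q, hq, rfl⟩, by rw [mul_comm s]; rfl⟩
  have hmem : ∀ x, x ∈ P ↔ ∃ a, a * π f = x := fun x => by
    rw [hp]; exact Ideal.mem_span_singleton'
  refine ⟨D, ?_, ?_⟩
  · ext x
    rw [Ideal.mem_map_iff_of_surjective π hπ.surjective, hmem]
    constructor
    · rintro ⟨d, hd, rfl⟩
      obtain ⟨s, q, -, rfl⟩ := (hD d).1 hd
      refine ⟨π f * π s, ?_⟩
      rw [map_add, hπ.map_two_mul, map_mul, map_pow]
      ring
    · rintro ⟨a, rfl⟩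
      obtain ⟨a, rfl⟩ := hπ.surjective a
      refine ⟨f ^ 2 * (f ^ l * a), (hD _).2 ⟨f ^ l * a, 0, by simp, by ring⟩, ?_⟩
      conv_rhs => rw [← hπ.pow_eq (π f)]
      simp only [map_mul, map_pow]
      ring
  · ext x
    obtain ⟨u, rfl⟩ := hπ.surjective x
    rw [hπ.mem_torsionIdeal, hD]
    constructor
    · rintro ⟨s, q, hq, h⟩
      have h1 : π (f * s) = 0 := by
        have h2 : π f ^ 2 * π s = 0 := by
          have := congrArg π h
          rw [hπ.map_two_mul, map_add, hπ.map_two_mul, add_zero, map_mul, map_pow] at this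
          exact this.symm
        rw [map_mul, ← hπ.pow_eq (π f), pow_add, mul_assoc, h2, mul_zero]
      obtain ⟨t, ht⟩ := (hπ.eq_zero_iff _).1 h1
      have h3 : 2 * u = 2 * (f * t + q) := by
        rw [h, pow_two, mul_assoc, ht]; ring
      have h4 : π u = π (f * t + q) := by
        rw [← sub_eq_zero, ← map_sub, ← hπ.two_mul_eq_zero, mul_sub, h3, sub_self]
      rw [h4, map_add]
      refine Q.add_mem (hPQ ((hmem _).2 ⟨π t, ?_⟩)) hq
      rw [map_mul, mul_comm]
    · intro h
      exact ⟨0, u, h, by ring⟩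

end Residue

open scoped Pointwise

/-! ### Cyclotomic cosets modulo `n` -/

section Cosets

/-- Two residues are related if they lie in the same `2`-cyclotomic coset modulo `n`. -/
def doublingSetoid (n : ℕ) : Setoid (ZMod n) where
  r x y := ∃ k l : ℕ, 2 ^ k • x = 2 ^ l • y
  iseqv := by
    refine ⟨fun x => ⟨0, 0, rfl⟩, fun ⟨k, l, h⟩ => ⟨l, k, h.symm⟩, ?_⟩
    rintro x y z ⟨k, l, h⟩ ⟨k', l', h'⟩
    refine ⟨k' + k, l + l', ?_⟩
    rw [pow_add, mul_smul, h, ← mul_smul, mul_comm, mul_smul, h', ← mul_smul, ← pow_add]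

/-- The set of `2`-cyclotomic cosets modulo `n`. -/
def Coset (n : ℕ) : Type := Quotient (doublingSetoid n)

/-- The `2`-cyclotomic coset of a residue. -/
def Coset.mk {n : ℕ} (x : ZMod n) : Coset n := Quotient.mk (doublingSetoid n) x

variable {n : ℕ}

theorem Coset.mk_surjective : Function.Surjective (Coset.mk : ZMod n → Coset n) :=
  Quotient.mk_surjective

theorem Coset.mk_eq_mk {x y : ZMod n} : mk x = mk y ↔ ∃ k l : ℕ, 2 ^ k • x = 2 ^ l • y :=
  Quotient.eq (r := doublingSetoid n)

noncomputable instance : DecidableEq (Coset n) := Classical.decEq _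

noncomputable instance [NeZero n] : Fintype (Coset n) :=
  Fintype.ofSurjective _ Coset.mk_surjective

instance : Neg (Coset n) :=
  ⟨Quotient.map (- ·) (by rintro x y ⟨k, l, h⟩; exact ⟨k, l, by rw [smul_neg, smul_neg, h]⟩)⟩

theorem Coset.neg_mk (x : ZMod n) : -mk x = mk (-x) := rfl

instance : InvolutiveNeg (Coset n) where
  neg_neg q := by
    obtain ⟨x, rfl⟩ := Coset.mk_surjective q
    rw [Coset.neg_mk, Coset.neg_mk, neg_neg]

theorem Coset.mk_two_nsmul (x : ZMod n) : mk (2 • x) = mk x :=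
  mk_eq_mk.2 ⟨0, 1, by simp⟩

/-- Doubling is invertible modulo an odd `n`, so one exponent suffices. -/
theorem Coset.mk_eq_mk_of_odd (hn : Odd n) {x y : ZMod n} :
    mk x = mk y ↔ ∃ k : ℕ, y = 2 ^ k • x := by
  constructor
  · intro h
    obtain ⟨k, l, h⟩ := mk_eq_mk.1 h
    have h1 : ((2 ^ n.totient : ℕ) : ZMod n) = 1 := by
      rw [← Nat.cast_one, ZMod.natCast_eq_natCast_iff]
      exact Nat.ModEq.pow_totient (Nat.coprime_two_left.2 hn)
    have hpos : 0 < n.totient := Nat.totient_pos.2 hn.pos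
    have h2 : l * n.totient - l + l = l * n.totient :=
      Nat.sub_add_cancel (Nat.le_mul_of_pos_right _ hpos)
    -- Multiplication by `2 ^ (l * φ(n) - l)` inverts multiplication by `2 ^ l`.
    refine ⟨l * n.totient - l + k, ?_⟩
    rw [pow_add, mul_smul, h, ← mul_smul, ← pow_add, h2, mul_comm, pow_mul, nsmul_eq_mul,
      Nat.cast_pow, h1, one_pow, one_mul]
  · rintro ⟨k, rfl⟩
    exact mk_eq_mk.2 ⟨k, 0, by simp⟩

variable [NeZero n]

/-- The residues that lie in the cosets of `t`. -/
noncomputable def residues (t : Finset (Coset n)) : Finset (ZMod n) := {x | Coset.mk x ∈ t}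

theorem mem_residues {t : Finset (Coset n)} {x : ZMod n} : x ∈ residues t ↔ Coset.mk x ∈ t := by
  simp [residues]

end Cosets

/-! ### Fourier transform and the ideals of the binary group algebra -/

section Fourier

open AddMonoidAlgebra

variable {n : ℕ} [NeZero n] {F : Type*} [Field F] [Algebra (ZMod 2) F] {ψ : AddChar (ZMod n) F}

/-- The ring of binary vectors of length `n` with cyclic convolution. -/
abbrev BinAlg (n : ℕ) : Type := AddMonoidAlgebra (ZMod 2) (ZMod n)

/-- The usual factor `n` equals 1 in characteristic 2, so inversion needs no normalisation. -/
theorem fourier_sum (hn : Odd n) (hψ : ψ.IsPrimitive) (a b : ZMod n) :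
    ∑ i, ψ (i * a) * ψ (-(i * b)) = if a = b then (1 : F) else 0 := by
  have : CharP F 2 := charP_of_injective_algebraMap (algebraMap (ZMod 2) F).injective 2
  have h : (n : F) = 1 := by
    obtain ⟨k, rfl⟩ := hn
    push_cast
    rw [CharTwo.two_eq_zero]
    ring
  have h2 := AddChar.sum_mulShift (a - b) hψ
  simp only [← AddChar.map_add_eq_mul, ← sub_eq_add_neg, ← mul_sub]
  rw [h2]
  simp [sub_eq_zero, ZMod.card, h]

theorem fourier_injective (hn : Odd n) (hψ : ψ.IsPrimitive) {f : ZMod n → F}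
    (h : ∀ i, ∑ s, f s * ψ (i * s) = 0) : f = 0 := by
  funext t
  calc f t = ∑ s, f s * ∑ i, ψ (i * s) * ψ (-(i * t)) := by
        simp [fourier_sum hn hψ]
    _ = ∑ i, (∑ s, f s * ψ (i * s)) * ψ (-(i * t)) := by
        simp only [Finset.mul_sum, Finset.sum_mul, mul_assoc]
        exact Finset.sum_comm
    _ = 0 := by simp [h]

/-- The value of an element of the binary group algebra at the `i`-th power of the root of unity
given by `ψ`. -/
noncomputable def fourier (ψ : AddChar (ZMod n) F) (i : ZMod n) : BinAlg n →ₐ[ZMod 2] F :=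
  AddMonoidAlgebra.lift (ZMod 2) F (ZMod n) (ψ.mulShift i).toMonoidHom

omit [NeZero n] in
theorem fourier_single (i s : ZMod n) (r : ZMod 2) :
    fourier ψ i (single s r) = algebraMap (ZMod 2) F r * ψ (i * s) := by
  simp [fourier, Algebra.smul_def, AddChar.mulShift_apply]

theorem fourier_apply (i : ZMod n) (u : BinAlg n) :
    fourier ψ i u = ∑ s, algebraMap (ZMod 2) F (u.coeff s) * ψ (i * s) := by
  rw [fourier, AddMonoidAlgebra.lift_apply, Finsupp.sum_fintype _ _ (by simp)]
  simp [Algebra.smul_def, AddChar.mulShift_apply]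

theorem eq_of_fourier (hn : Odd n) (hψ : ψ.IsPrimitive) {u v : BinAlg n}
    (h : ∀ i, fourier ψ i u = fourier ψ i v) : u = v := by
  rw [← sub_eq_zero]
  have h0 : (fun s => algebraMap (ZMod 2) F ((u - v).coeff s)) = 0 := by
    refine fourier_injective hn hψ fun i => ?_
    rw [← fourier_apply, map_sub, h, sub_self]
  ext s
  have h1 := congrFun h0 s
  simp only [Pi.zero_apply, map_eq_zero] at h1
  rw [h1]
  rfl

omit [NeZero n] in
-- Frobenius fixes the binary coefficients and doubles the argument of `ψ`.
theorem fourier_two_nsmul (i : ZMod n) (u : BinAlg n) :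
    fourier ψ (2 • i) u = fourier ψ i u ^ 2 := by
  have : CharP F 2 := charP_of_injective_algebraMap (algebraMap (ZMod 2) F).injective 2
  have h : (fourier ψ (2 • i) : BinAlg n →+* F) =
      (frobenius F 2).comp (fourier ψ i : BinAlg n →+* F) := by
    refine AddMonoidAlgebra.ringHom_ext (fun r => ?_) (fun s => ?_)
    · simp only [RingHom.coe_coe, RingHom.comp_apply, frobenius_def, fourier_single, mul_zero,
        AddChar.map_zero_eq_one, mul_one]
      rw [← map_pow, ZMod.pow_card]
    · simp only [RingHom.coe_coe, RingHom.comp_apply, frobenius_def, fourier_single, map_one,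
        one_mul, smul_mul_assoc, AddChar.map_nsmul_eq_pow]
  exact congrArg (fun f : BinAlg n →+* F => f u) h

omit [NeZero n] in
theorem fourier_two_pow_nsmul (k : ℕ) (i : ZMod n) (u : BinAlg n) :
    fourier ψ (2 ^ k • i) u = fourier ψ i u ^ 2 ^ k := by
  induction k with
  | zero => simp
  | succ k ih => rw [pow_succ', mul_smul, fourier_two_nsmul, ih, ← pow_mul, ← pow_succ, pow_succ']

theorem binAlg_pow_eq (hn : Odd n) (hψ : ψ.IsPrimitive) (u : BinAlg n) :
    u ^ 2 ^ n.totient = u := by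
  refine eq_of_fourier hn hψ fun i => ?_
  have h1 : ((2 ^ n.totient : ℕ) : ZMod n) = 1 := by
    rw [← Nat.cast_one, ZMod.natCast_eq_natCast_iff]
    exact Nat.ModEq.pow_totient (Nat.coprime_two_left.2 hn)
  rw [map_pow, ← fourier_two_pow_nsmul, nsmul_eq_mul, h1, one_mul]

/-- The inverse transform of the indicator of `t` has coefficients fixed by squaring, because
doubling permutes the residues of `t`; hence they lie in `𝔽₂`. -/
theorem exists_idempotent (hn : Odd n) (hψ : ψ.IsPrimitive) (t : Finset (Coset n)) :
    ∃ e : BinAlg n, ∀ i, fourier ψ i e = if Coset.mk i ∈ t then 1 else 0 := by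
  have : CharP F 2 := charP_of_injective_algebraMap (algebraMap (ZMod 2) F).injective 2
  let c : ZMod n → F := fun s => ∑ i ∈ residues t, ψ (-(i * s))
  have hinj : Function.Injective fun i : ZMod n => 2 • i := by
    intro i j hij
    have h2 : IsUnit ((2 : ℕ) : ZMod n) :=
      (ZMod.isUnit_iff_coprime 2 n).2 (Nat.coprime_two_left.2 hn)
    exact h2.mul_left_cancel (by simpa [nsmul_eq_mul] using hij)
  have hc : ∀ s, c s ^ 2 = c s := by
    intro s
    simp only [c]
    rw [CharTwo.sum_sq]
    refine Finset.sum_nbij (fun i => 2 • i) (fun i hi => ?_) hinj.injOn (fun i hi => ?_)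
      (fun i _ => ?_)
    · rw [mem_residues] at hi ⊢
      rwa [Coset.mk_two_nsmul]
    · obtain ⟨j, rfl⟩ := (Finite.injective_iff_surjective.1 hinj) i
      refine ⟨j, ?_, rfl⟩
      rw [Finset.mem_coe, mem_residues] at hi ⊢
      rwa [← Coset.mk_two_nsmul]
    · rw [← AddChar.map_nsmul_eq_pow, smul_neg, smul_mul_assoc]
  have hc' : ∀ s, ∃ r : ZMod 2, algebraMap (ZMod 2) F r = c s := by
    intro s
    have h : c s * (c s - 1) = 0 := by linear_combination hc s
    rcases mul_eq_zero.1 h with h | h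
    · exact ⟨0, by rw [map_zero, h]⟩
    · exact ⟨1, by rw [map_one, sub_eq_zero.1 h]⟩
  choose r hr using hc'
  refine ⟨ofCoeff (Finsupp.equivFunOnFinite.symm r), fun i => ?_⟩
  rw [fourier_apply]
  simp only [Finsupp.equivFunOnFinite_symm_apply_apply, hr, c, Finset.sum_mul]
  rw [Finset.sum_comm]
  have h : ∀ j, ∑ s, ψ (-(j * s)) * ψ (i * s) = if i = j then (1 : F) else 0 := by
    intro j
    rw [← fourier_sum hn hψ i j]
    exact Finset.sum_congr rfl fun s _ => by rw [mul_comm, mul_comm i, mul_comm j]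
  simp [h, mem_residues]

/-- The ideal of the binary vectors whose Fourier transform is supported in the cosets of `t`. -/
noncomputable def cosetIdeal (ψ : AddChar (ZMod n) F) (t : Finset (Coset n)) : Ideal (BinAlg n) :=
  ⨅ i, ⨅ (_ : Coset.mk i ∉ t), RingHom.ker (fourier ψ i)

omit [NeZero n] in
theorem mem_cosetIdeal {t : Finset (Coset n)} {u : BinAlg n} :
    u ∈ cosetIdeal ψ t ↔ ∀ i, Coset.mk i ∉ t → fourier ψ i u = 0 := by
  simp [cosetIdeal, Submodule.mem_iInf, RingHom.mem_ker]

omit [NeZero n] in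
theorem cosetIdeal_inf (s t : Finset (Coset n)) :
    cosetIdeal ψ s ⊓ cosetIdeal ψ t = cosetIdeal ψ (s ∩ t) := by
  ext u
  simp only [Ideal.mem_inf, mem_cosetIdeal, Finset.mem_inter, not_and_or]
  exact ⟨fun h i hi => hi.elim (h.1 i) (h.2 i),
    fun h => ⟨fun i hi => h i (.inl hi), fun i hi => h i (.inr hi)⟩⟩

omit [NeZero n] in
theorem cosetIdeal_mono {s t : Finset (Coset n)} (h : s ⊆ t) : cosetIdeal ψ s ≤ cosetIdeal ψ t :=
  fun _ hu => mem_cosetIdeal.2 fun i hi => mem_cosetIdeal.1 hu i fun h' => hi (h h')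

theorem subset_of_cosetIdeal_le (hn : Odd n) (hψ : ψ.IsPrimitive) {s t : Finset (Coset n)}
    (h : cosetIdeal ψ s ≤ cosetIdeal ψ t) : s ⊆ t := by
  obtain ⟨e, he⟩ := exists_idempotent hn hψ s
  intro q hq
  obtain ⟨i, rfl⟩ := Coset.mk_surjective q
  by_contra hi
  have h1 := mem_cosetIdeal.1 (h (mem_cosetIdeal.2 fun j hj => by rw [he, if_neg hj])) i hi
  rw [he, if_pos hq] at h1
  exact one_ne_zero h1

theorem annihilator_cosetIdeal (hn : Odd n) (hψ : ψ.IsPrimitive) (t : Finset (Coset n)) :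
    Submodule.annihilator (cosetIdeal ψ t) = cosetIdeal ψ tᶜ := by
  obtain ⟨e, he⟩ := exists_idempotent hn hψ t
  ext u
  rw [Submodule.mem_annihilator, mem_cosetIdeal]
  constructor
  · intro h i hi
    have h1 := congrArg (fourier ψ i)
      (h e (mem_cosetIdeal.2 fun j hj => by rw [he, if_neg hj]))
    rw [Finset.mem_compl, not_not] at hi
    rwa [smul_eq_mul, map_mul, he, if_pos hi, mul_one, map_zero] at h1
  · intro h v hv
    refine eq_of_fourier hn hψ fun i => ?_
    rw [smul_eq_mul, map_mul, map_zero]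
    by_cases hi : Coset.mk i ∈ t
    · rw [h i (by simpa using hi), zero_mul]
    · rw [mem_cosetIdeal.1 hv i hi, mul_zero]

theorem cosetIdeal_isPrincipal (hn : Odd n) (hψ : ψ.IsPrimitive) (t : Finset (Coset n)) :
    (cosetIdeal ψ t).IsPrincipal := by
  obtain ⟨e, he⟩ := exists_idempotent hn hψ t
  refine ⟨e, le_antisymm (fun u hu => ?_) ?_⟩
  · refine Ideal.mem_span_singleton'.2 ⟨u, eq_of_fourier hn hψ fun i => ?_⟩
    rw [map_mul, he]
    split_ifs with hi
    · rw [mul_one]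
    · rw [mul_zero, mem_cosetIdeal.1 hu i hi]
  · rw [Submodule.span_singleton_le_iff_mem, mem_cosetIdeal]
    intro i hi
    rw [he, if_neg hi]

theorem exists_eq_cosetIdeal (hn : Odd n) (hψ : ψ.IsPrimitive) (I : Ideal (BinAlg n)) :
    ∃ t, I = cosetIdeal ψ t := by
  classical
  let t : Finset (Coset n) := {q | ∃ u ∈ I, ∃ i, Coset.mk i = q ∧ fourier ψ i u ≠ 0}
  have ht : ∀ q, q ∈ t ↔ ∃ u ∈ I, ∃ i, Coset.mk i = q ∧ fourier ψ i u ≠ 0 := by simp [t]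
  refine ⟨t, le_antisymm (fun u hu => mem_cosetIdeal.2 fun i hi => ?_) fun x hx => ?_⟩
  · by_contra h
    exact hi ((ht _).2 ⟨u, hu, i, rfl, h⟩)
  choose e he using fun q : Coset n => exists_idempotent hn hψ {q}
  have hpos : 0 < n.totient := Nat.totient_pos.2 hn.pos
  have hm : 2 ≤ 2 ^ n.totient := Nat.le_self_pow hpos.ne' 2
  obtain ⟨m, hm'⟩ : ∃ m, 2 ^ n.totient = m + 2 := ⟨_, (Nat.sub_add_cancel hm).symm⟩
  have heI : ∀ q ∈ t, e q ∈ I := by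
    intro q hq
    obtain ⟨u, hu, i, hi, hui⟩ := (ht q).1 hq
    -- As `u ^ (m + 2) = u`, the power `u ^ (m + 1)` has transform 1 wherever that of `u` is
    -- nonzero, which includes the whole coset `q`.
    have h : e q = e q * u ^ (m + 1) := by
      refine eq_of_fourier hn hψ fun j => ?_
      rw [map_mul, he]
      split_ifs with hj
      · rw [Finset.mem_singleton, ← hi, eq_comm, Coset.mk_eq_mk_of_odd hn] at hj
        obtain ⟨k, rfl⟩ := hj
        have h0 : fourier ψ (2 ^ k • i) u ≠ 0 := by
          rw [fourier_two_pow_nsmul]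
          exact pow_ne_zero _ hui
        have h1 := congrArg (fourier ψ (2 ^ k • i)) (binAlg_pow_eq hn hψ u)
        rw [hm', map_pow, show m + 2 = m + 1 + 1 from rfl, pow_succ] at h1
        rw [map_pow, one_mul]
        exact (mul_right_cancel₀ h0 (h1.trans (one_mul _).symm)).symm
      · rw [zero_mul]
    rw [h]
    exact I.mul_mem_left _ (I.pow_mem_of_mem hu _ m.succ_pos)
  have hx' : x = ∑ q ∈ t, e q * x := by
    refine eq_of_fourier hn hψ fun i => ?_
    simp only [map_sum, map_mul, he, Finset.mem_singleton, ite_mul, one_mul, zero_mul,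
      Finset.sum_ite_eq]
    split_ifs with hi
    · rfl
    · exact mem_cosetIdeal.1 hx i hi
  rw [hx']
  exact I.sum_mem fun q hq => I.mul_mem_right _ (heI q hq)

/-- The involution of a group algebra over `ZMod n` given by negation. -/
noncomputable abbrev reversal (R : Type*) [Semiring R] (n : ℕ) :
    AddMonoidAlgebra R (ZMod n) ≃+* AddMonoidAlgebra R (ZMod n) :=
  AddMonoidAlgebra.mapDomainRingEquiv R (AddEquiv.neg (ZMod n))

omit [NeZero n] in
theorem fourier_reversal (i : ZMod n) (u : BinAlg n) :
    fourier ψ i (reversal (ZMod 2) n u) = fourier ψ (-i) u := by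
  induction u using AddMonoidAlgebra.induction_linear with
  | zero => simp
  | add x y hx hy => rw [map_add, map_add, map_add, hx, hy]
  | single m r => simp [reversal, fourier_single]

omit [NeZero n] in
theorem comap_reversal_cosetIdeal (t : Finset (Coset n)) :
    (cosetIdeal ψ t).comap (reversal (ZMod 2) n : BinAlg n →+* BinAlg n) = cosetIdeal ψ (-t) := by
  ext u
  simp only [Ideal.mem_comap, mem_cosetIdeal, RingHom.coe_coe, fourier_reversal,
    Finset.mem_neg', Coset.neg_mk]
  exact ⟨fun h i hi => by simpa using h (-i) hi, fun h i hi => h (-i) (by simpa using hi)⟩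

/-- A binary basis stays independent over `F` after the transform, and the transforms live on the
residues of `t`. -/
theorem finrank_cosetIdeal_le (hn : Odd n) (hψ : ψ.IsPrimitive) (t : Finset (Coset n)) :
    Module.finrank (ZMod 2) ((cosetIdeal ψ t).restrictScalars (ZMod 2)) ≤ (residues t).card := by
  set V := (cosetIdeal ψ t).restrictScalars (ZMod 2)
  have : Module.Finite (ZMod 2) V := inferInstance
  let b := Module.finBasis (ZMod 2) V
  let g : Fin (Module.finrank (ZMod 2) V) → residues t → F := fun k i => fourier ψ i.1 (b k).1
  have hg : LinearIndependent F g := by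
    rw [Fintype.linearIndependent_iff]
    intro c hc
    have h0 : (fun s => ∑ k, c k * algebraMap (ZMod 2) F ((b k).1.coeff s)) = 0 := by
      refine fourier_injective hn hψ fun i => ?_
      have h1 : ∑ k, c k * fourier ψ i (b k).1 = 0 := by
        by_cases hi : i ∈ residues t
        · simpa [g] using congrFun hc ⟨i, hi⟩
        · refine Finset.sum_eq_zero fun k _ => ?_
          rw [mem_cosetIdeal.1 (b k).2 i (fun h => hi (mem_residues.2 h)), mul_zero]
      rw [← h1]
      simp only [fourier_apply, Finset.sum_mul, Finset.mul_sum, mul_assoc]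
      exact Finset.sum_comm
    intro k
    -- Any `𝔽₂`-linear functional turns the relation over `F` into one over `𝔽₂`, which must be
    -- trivial.
    refine (Module.forall_dual_apply_eq_zero_iff (ZMod 2) (c k)).1 fun l => ?_
    have h2 : ∑ k, l (c k) • b k = 0 := by
      apply Subtype.ext
      ext s
      have h3 := congrArg l (congrFun h0 s)
      simp only [Pi.zero_apply, map_zero, map_sum] at h3
      simp only [Submodule.coe_sum, Submodule.coe_smul, AddMonoidAlgebra.coeff_sum,
        Finsupp.coe_finsetSum, Finset.sum_apply, AddMonoidAlgebra.coeff_smul_apply, smul_eq_mul,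
        Submodule.coe_zero, AddMonoidAlgebra.coeff_zero, Finsupp.coe_zero, Pi.zero_apply]
      rw [← h3]
      refine Finset.sum_congr rfl fun k _ => ?_
      rw [mul_comm (c k), ← Algebra.smul_def, map_smul, smul_eq_mul, mul_comm]
    exact Fintype.linearIndependent_iff.1 b.linearIndependent _ h2 k
  have := hg.fintype_card_le_finrank
  simpa using this

/-- The ideals of `t` and `tᶜ` together span a space of dimension `n`, the sum of their two upper
bounds, so both bounds are attained. -/
theorem card_cosetIdeal (hn : Odd n) (hψ : ψ.IsPrimitive) (t : Finset (Coset n)) :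
    Nat.card (cosetIdeal ψ t) = 2 ^ (residues t).card := by
  have h1 := finrank_cosetIdeal_le hn hψ t
  have h2 := finrank_cosetIdeal_le hn hψ tᶜ
  have hsup : (cosetIdeal ψ t).restrictScalars (ZMod 2) ⊔
      (cosetIdeal ψ tᶜ).restrictScalars (ZMod 2) = ⊤ := by
    obtain ⟨e, he⟩ := exists_idempotent hn hψ t
    refine eq_top_iff.2 fun u _ => Submodule.mem_sup.2 ⟨u * e, ?_, u - u * e, ?_, by ring⟩
    · rw [Submodule.restrictScalars_mem, mem_cosetIdeal]
      intro i hi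
      rw [map_mul, he, if_neg hi, mul_zero]
    · rw [Submodule.restrictScalars_mem, mem_cosetIdeal]
      intro i hi
      rw [Finset.mem_compl, not_not] at hi
      rw [map_sub, map_mul, he, if_pos hi, mul_one, sub_self]
  have h3 := Submodule.finrank_add_le_finrank_add_finrank
    ((cosetIdeal ψ t).restrictScalars (ZMod 2)) ((cosetIdeal ψ tᶜ).restrictScalars (ZMod 2))
  rw [hsup, finrank_top, (AddMonoidAlgebra.coeffLinearEquiv (ZMod 2)).finrank_eq,
    Module.finrank_finsupp_self, ZMod.card] at h3
  have h4 : (residues t).card + (residues tᶜ).card = n := by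
    have : residues tᶜ = (residues t)ᶜ := by ext; simp [mem_residues]
    rw [this, Finset.card_add_card_compl, ZMod.card]
  have h5 := Module.natCard_eq_pow_finrank (K := ZMod 2)
    (V := (cosetIdeal ψ t).restrictScalars (ZMod 2))
  rw [Nat.card_zmod] at h5
  refine h5.trans ?_
  congr 1
  omega

end Fourier

/-! ### Counting cosets by additive order -/

section Counting

variable {n : ℕ}

theorem coprime_two_of_mem_divisors (hn : Odd n) {j : ℕ} (hj : j ∈ n.divisors) :
    Nat.Coprime 2 j :=
  Nat.coprime_two_left.2 (hn.of_dvd_nat (Nat.dvd_of_mem_divisors hj))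

theorem ord_dvd_totient {j : ℕ} (hj : Nat.Coprime 2 j) : ord j ∣ j.totient := by
  refine orderOf_dvd_of_pow_eq_one ?_
  have h := (ZMod.natCast_eq_natCast_iff _ _ j).2 (Nat.ModEq.pow_totient hj)
  simpa using h

theorem ord_pos {j : ℕ} (hj : Nat.Coprime 2 j) (h0 : 0 < j) : 0 < ord j :=
  Nat.pos_of_dvd_of_pos (ord_dvd_totient hj) (Nat.totient_pos.2 h0)

theorem two_pow_nsmul_eq_iff {x : ZMod n} {k l : ℕ} :
    2 ^ k • x = 2 ^ l • x ↔ (2 : ZMod (addOrderOf x)) ^ k = 2 ^ l := by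
  rw [nsmul_eq_nsmul_iff_modEq, ← ZMod.natCast_eq_natCast_iff]
  push_cast
  rfl

/-- The common additive order of the elements of a coset. -/
noncomputable def Coset.order (q : Coset n) : ℕ := addOrderOf (Quotient.out q)

theorem addOrderOf_coprime_two [NeZero n] (hn : Odd n) (x : ZMod n) :
    (addOrderOf x).Coprime 2 := by
  refine Nat.coprime_two_right.2 (hn.of_dvd_nat ?_)
  have := addOrderOf_dvd_natCard x
  rwa [Nat.card_zmod] at this

variable [NeZero n]

theorem Coset.order_mk (hn : Odd n) (x : ZMod n) : (mk x).order = addOrderOf x := by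
  have h : mk (Quotient.out (mk x)) = mk x := Quotient.out_eq (mk x)
  rw [eq_comm, mk_eq_mk_of_odd hn] at h
  obtain ⟨k, hk⟩ := h
  rw [order, hk, Nat.Coprime.addOrderOf_nsmul ((addOrderOf_coprime_two hn x).pow_right k)]

theorem Coset.order_neg (hn : Odd n) (q : Coset n) : (-q).order = q.order := by
  obtain ⟨x, rfl⟩ := mk_surjective q
  rw [neg_mk, order_mk hn, order_mk hn, addOrderOf_neg]

theorem Coset.order_mem_divisors (q : Coset n) : q.order ∈ n.divisors := by
  have := addOrderOf_dvd_natCard (Quotient.out q)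
  rw [Nat.card_zmod] at this
  exact Nat.mem_divisors.2 ⟨this, NeZero.ne n⟩

theorem Coset.card_residues_singleton (hn : Odd n) (q : Coset n) :
    (residues {q}).card = ord q.order := by
  obtain ⟨x, rfl⟩ := mk_surjective q
  have hpos : 0 < ord (addOrderOf x) :=
    ord_pos (addOrderOf_coprime_two hn x).symm (addOrderOf_pos x)
  have h : residues {mk x} = (Finset.range (ord (addOrderOf x))).image fun k => 2 ^ k • x := by
    ext y
    simp only [mem_residues, Finset.mem_singleton, Finset.mem_image, Finset.mem_range]
    rw [eq_comm, mk_eq_mk_of_odd hn]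
    constructor
    · rintro ⟨k, rfl⟩
      refine ⟨k % ord (addOrderOf x), Nat.mod_lt _ hpos, ?_⟩
      rw [two_pow_nsmul_eq_iff]
      exact pow_mod_orderOf _ _
    · rintro ⟨k, -, rfl⟩
      exact ⟨k, rfl⟩
  rw [order_mk hn, h, Finset.card_image_of_injOn, Finset.card_range]
  intro k hk l hl hkl
  refine pow_injOn_Iio_orderOf (Finset.mem_range.1 hk) (Finset.mem_range.1 hl) ?_
  exact two_pow_nsmul_eq_iff.1 hkl

theorem card_residues (hn : Odd n) (t : Finset (Coset n)) :
    (residues t).card = ∑ j ∈ n.divisors, ord j * {q ∈ t | q.order = j}.card := by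
  have h1 : (residues t).card = ∑ q ∈ t, ord q.order := by
    rw [Finset.card_eq_sum_card_fiberwise (f := Coset.mk) (t := t) fun x hx => mem_residues.1 hx]
    refine Finset.sum_congr rfl fun q hq => ?_
    rw [← Coset.card_residues_singleton hn]
    congr 1
    ext x
    simp only [Finset.mem_filter, mem_residues, Finset.mem_singleton, and_iff_right_iff_imp]
    rintro rfl
    exact hq
  rw [h1, ← Finset.sum_fiberwise_of_maps_to (g := Coset.order) (t := n.divisors)
    fun q _ => q.order_mem_divisors]
  refine Finset.sum_congr rfl fun j _ => ?_
  rw [Finset.sum_congr rfl (g := fun _ => ord j) fun q hq => by rw [(Finset.mem_filter.1 hq).2],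
    Finset.sum_const, smul_eq_mul, mul_comm]

/-- The cosets of residues of additive order `j`. -/
noncomputable def level (n j : ℕ) [NeZero n] : Finset (Coset n) := {q | q.order = j}

theorem mem_level {j : ℕ} {q : Coset n} : q ∈ level n j ↔ q.order = j := by simp [level]

theorem card_level_mul_ord (hn : Odd n) {j : ℕ} (hj : j ∈ n.divisors) :
    (level n j).card * ord j = j.totient := by
  have h := IsAddCyclic.card_addOrderOf_eq_totient (α := ZMod n) (d := j)
    (by rw [ZMod.card]; exact Nat.dvd_of_mem_divisors hj)
  have h1 : ({x : ZMod n | addOrderOf x = j} : Finset (ZMod n)) = residues (level n j) := by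
    ext x
    simp [mem_residues, mem_level, Coset.order_mk hn]
  rw [← h, h1, card_residues hn, Finset.sum_eq_single_of_mem j hj, mul_comm]
  · congr 2
    ext q
    simp [mem_level]
  · intro i _ hij
    rw [Finset.filter_eq_empty_iff.2, Finset.card_empty, mul_zero]
    intro q hq
    rw [mem_level.1 hq]
    exact hij.symm

theorem card_level (hn : Odd n) {j : ℕ} (hj : j ∈ n.divisors) : (level n j).card = γ j :=
  Nat.eq_div_of_mul_eq_left
    (ord_pos (coprime_two_of_mem_divisors hn hj) (Nat.pos_of_mem_divisors hj)).ne'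
    (card_level_mul_ord hn hj)

theorem Coset.neg_eq_self_iff (hn : Odd n) (q : Coset n) : -q = q ↔ q.order ∈ N₂ := by
  obtain ⟨x, rfl⟩ := mk_surjective q
  rw [neg_mk, eq_comm, mk_eq_mk_of_odd hn, order_mk hn]
  have key : ∀ k : ℕ, -x = 2 ^ k • x ↔ addOrderOf x ∣ 2 ^ k + 1 := by
    intro k
    rw [addOrderOf_dvd_iff_nsmul_eq_zero, add_smul, one_smul, neg_eq_iff_add_eq_zero, add_comm]
  simp only [key]
  refine ⟨fun ⟨k, hk⟩ => ⟨addOrderOf_pos x, ?_⟩, fun ⟨_, k, _, hk⟩ => ⟨k, hk⟩⟩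
  -- `N₂` demands a positive exponent; adding the totient leaves the power of 2 unchanged modulo the
  -- order.
  refine ⟨k + (addOrderOf x).totient, ?_, ?_⟩
  · have := Nat.totient_pos.2 (addOrderOf_pos x)
    omega
  · rw [← ZMod.natCast_eq_zero_iff] at hk ⊢
    have h := (ZMod.natCast_eq_natCast_iff _ _ _).2
      (Nat.ModEq.pow_totient (addOrderOf_coprime_two hn x).symm)
    push_cast at hk h ⊢
    rw [pow_add, h, mul_one, hk]

theorem neg_mem_level (hn : Odd n) {j : ℕ} {q : Coset n} : -q ∈ level n j ↔ q ∈ level n j := by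
  rw [mem_level, mem_level, Coset.order_neg hn]

/-- Negation acts on the level without fixed points, so `γ j` is even. -/
theorem card_level_of_notMem (hn : Odd n) {j : ℕ} (hj : j ∈ n.divisors) (hj' : j ∉ N₂) :
    (level n j).card = 2 * β j := by
  have h : Even (level n j).card := by
    rw [← ZMod.natCast_eq_zero_iff_even, Finset.card_eq_sum_ones, Nat.cast_sum]
    refine Finset.sum_involution (fun q _ => -q) (fun _ _ => by decide) (fun q hq _ h => ?_)
      (fun q hq => (neg_mem_level hn).2 hq) (fun q _ => neg_neg q)
    rw [Coset.neg_eq_self_iff hn, mem_level.1 hq] at h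
    exact hj' h
  have hβ : β j = γ j / 2 := by rw [β, γ, Nat.div_div_eq_div_mul, mul_comm]
  rw [hβ, ← card_level hn hj, Nat.two_mul_div_two_of_even h]

/-- Greedy choice: while `2 * A.card < L.card`, some element of `L` avoids `A ∪ -A`. -/
theorem exists_subset_disjoint_neg {α : Type*} [DecidableEq α] [InvolutiveNeg α] (L : Finset α)
    (hL : ∀ x ∈ L, -x ≠ x) (a : ℕ) (ha : 2 * a ≤ L.card) :
    ∃ A ⊆ L, A.card = a ∧ ∀ x ∈ A, -x ∉ A := by
  induction a with
  | zero => exact ⟨∅, by simp, rfl, by simp⟩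
  | succ a ih =>
    obtain ⟨A, hAL, hA, hneg⟩ := ih (by omega)
    have hcard : (A ∪ -A).card < L.card := by
      have := Finset.card_union_le A (-A)
      rw [Finset.card_neg] at this
      omega
    obtain ⟨x, hx, hxA⟩ := Finset.exists_mem_notMem_of_card_lt_card hcard
    rw [Finset.mem_union, Finset.mem_neg', not_or] at hxA
    refine ⟨insert x A, Finset.insert_subset hx hAL,
      by rw [Finset.card_insert_of_notMem hxA.1, hA], fun y hy => ?_⟩
    rw [Finset.mem_insert] at hy ⊢
    rintro (h | h)
    · rcases hy with rfl | hy
      · exact hL _ hx h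
      · exact hxA.2 (by rwa [← h, neg_neg])
    · rcases hy with rfl | hy
      · exact hxA.2 h
      · exact hneg y hy h

/-- The condition on `k₁` and `k₂` for a hull of a cyclic code over `ℤ₄`. -/
def IsAdmissible (n k₁ k₂ : ℕ) : Prop :=
  ∃ a b c : ℕ → ℕ, (∀ j ∈ n.divisors, j ∈ N₂ → b j ≤ γ j) ∧
    (∀ j ∈ n.divisors, j ∉ N₂ → a j ≤ β j ∧ c j ≤ 2 * (β j - a j)) ∧
    k₁ = ∑ j ∈ n.divisors with j ∉ N₂, ord j * a j ∧
    k₂ = ∑ j ∈ n.divisors with j ∈ N₂, ord j * b j + ∑ j ∈ n.divisors with j ∉ N₂, ord j * c j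

/-- With `w = p ∩ -qᶜ ⊆ v = q ∩ -pᶜ`, let `a` count `w` and `c` count `v \ w` on each level. A
self-negative coset cannot lie in `w`, and `v` is disjoint from `-w`, so `2a + c ≤ 2β` off `N₂`. -/
theorem isAdmissible_of_subset (hn : Odd n) {p q : Finset (Coset n)} (hpq : p ⊆ q) :
    ∃ k₁ k₂, IsAdmissible n k₁ k₂ ∧ (residues (p ∩ -qᶜ)).card = k₁ ∧
      (residues (q ∩ -pᶜ)).card = k₁ + k₂ := by
  set w := p ∩ -qᶜ with hw
  set v := q ∩ -pᶜ with hv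
  have mw : ∀ x, x ∈ w ↔ x ∈ p ∧ -x ∉ q := by simp [w, Finset.mem_neg']
  have mv : ∀ x, x ∈ v ↔ x ∈ q ∧ -x ∉ p := by simp [v, Finset.mem_neg']
  have hwv : w ⊆ v := fun x hx => (mv x).2 ⟨hpq ((mw x).1 hx).1, fun h => ((mw x).1 hx).2 (hpq h)⟩
  let a : ℕ → ℕ := fun j => {x ∈ w | x.order = j}.card
  let b : ℕ → ℕ := fun j => {x ∈ v | x.order = j}.card
  let c : ℕ → ℕ := fun j => {x ∈ v \ w | x.order = j}.card
  have hbac : ∀ j, b j = a j + c j := by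
    intro j
    simp only [a, b, c]
    rw [← Finset.card_union_of_disjoint, ← Finset.filter_union, Finset.union_sdiff_of_subset hwv]
    exact Finset.disjoint_filter_filter Finset.disjoint_sdiff
  have ha0 : ∀ j ∈ N₂, a j = 0 := by
    intro j hj
    simp only [a]
    rw [Finset.card_eq_zero, Finset.filter_eq_empty_iff]
    rintro x hx rfl
    rw [← Coset.neg_eq_self_iff hn] at hj
    have := (mw x).1 hx
    rw [hj] at this
    exact this.2 (hpq this.1)
  have hsplit : ∀ f : ℕ → ℕ, ∑ j ∈ n.divisors, f j =
      ∑ j ∈ n.divisors with j ∈ N₂, f j + ∑ j ∈ n.divisors with j ∉ N₂, f j := fun f =>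
    (Finset.sum_filter_add_sum_filter_not _ _ _).symm
  refine ⟨_, _, ⟨a, b, c, fun j hj _ => ?_, fun j hj hj' => ?_, rfl, rfl⟩, ?_, ?_⟩
  · rw [← card_level hn hj]
    exact Finset.card_le_card fun x hx => mem_level.2 (Finset.mem_filter.1 hx).2
  · have h : 2 * a j + c j ≤ 2 * β j := by
      rw [← card_level_of_notMem hn hj hj']
      have h1 : a j = ({x ∈ -w | x.order = j} : Finset (Coset n)).card := by
        simp only [a]
        rw [← Finset.card_neg]
        congr 1
        ext x
        simp [Finset.mem_neg', Coset.order_neg hn]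
      have h2 : b j + a j = ({x ∈ v ∪ -w | x.order = j} : Finset (Coset n)).card := by
        rw [h1, Finset.filter_union, Finset.card_union_of_disjoint]
        refine Finset.disjoint_filter_filter (Finset.disjoint_left.2 fun x hx hx' => ?_)
        exact ((mv x).1 hx).2 ((mw _).1 (Finset.mem_neg'.1 hx')).1
      have h3 : b j + a j ≤ (level n j).card := by
        rw [h2]
        exact Finset.card_le_card fun x hx => mem_level.2 (Finset.mem_filter.1 hx).2
      have := hbac j
      omega
    omega
  · rw [card_residues hn, hsplit]
    refine (Nat.add_eq_right).2 (Finset.sum_eq_zero fun j hj => ?_)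
    rw [show Finset.card _ = 0 from ha0 j (Finset.mem_filter.1 hj).2, mul_zero]
  · rw [card_residues hn, hsplit, add_left_comm, ← Finset.sum_add_distrib]
    congr 1
    refine Finset.sum_congr rfl fun j _ => ?_
    rw [← mul_add, ← hbac]

/-- On each level outside `N₂`, take `A` with no opposite pair and `S` outside `A ∪ -A`; inside
`N₂`, take `A` empty. With `p = A` and `q = A ∪ S` over all levels, both intersections leave `p` and
`q` unchanged. -/
theorem IsAdmissible.exists_subset (hn : Odd n) {k₁ k₂ : ℕ} (h : IsAdmissible n k₁ k₂) :
    ∃ p q : Finset (Coset n), p ⊆ q ∧ (residues (p ∩ -qᶜ)).card = k₁ ∧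
      (residues (q ∩ -pᶜ)).card = k₁ + k₂ := by
  obtain ⟨a, b, c, hb, hac, rfl, rfl⟩ := h
  have key : ∀ j, ∃ A S : Finset (Coset n), j ∈ n.divisors → A ⊆ level n j ∧ S ⊆ level n j ∧
      Disjoint A S ∧ (∀ x ∈ A, -x ∉ A ∧ -x ∉ S) ∧ A.card = (if j ∈ N₂ then 0 else a j) ∧
      S.card = if j ∈ N₂ then b j else c j := by
    intro j
    by_cases hj : j ∈ n.divisors
    swap
    · exact ⟨∅, ∅, fun h => absurd h hj⟩
    by_cases hj' : j ∈ N₂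
    · obtain ⟨S, hS, hcard⟩ := Finset.exists_subset_card_eq
        ((hb j hj hj').trans_eq (card_level hn hj).symm)
      exact ⟨∅, S, fun _ => by simp [hS, hcard, hj']⟩
    · obtain ⟨h1, h2⟩ := hac j hj hj'
      have hcard := card_level_of_notMem hn hj hj'
      obtain ⟨A, hA, hAc, hneg⟩ := exists_subset_disjoint_neg (level n j) (fun x hx h => by
        rw [Coset.neg_eq_self_iff hn, mem_level.1 hx] at h
        exact hj' h) (a j) (by omega)
      have h3 : c j ≤ (level n j \ (A ∪ -A)).card := by
        have h4 := Finset.le_card_sdiff (A ∪ -A) (level n j)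
        have h5 := Finset.card_union_le A (-A)
        rw [Finset.card_neg] at h5
        omega
      obtain ⟨S, hS, hSc⟩ := Finset.exists_subset_card_eq h3
      have hS' : ∀ x ∈ S, x ∉ A ∧ -x ∉ A := fun x hx => by
        have := (Finset.mem_sdiff.1 (hS hx)).2
        rwa [Finset.mem_union, Finset.mem_neg', not_or] at this
      refine ⟨A, S, fun _ => ⟨hA, hS.trans Finset.sdiff_subset,
        Finset.disjoint_right.2 fun x hx => (hS' x hx).1, fun x hx => ⟨hneg x hx, fun h => ?_⟩,
        by rw [if_neg hj', hAc], by rw [if_neg hj', hSc]⟩⟩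
      exact (hS' _ h).2 (by rwa [neg_neg])
  choose A S hAS using key
  let p : Finset (Coset n) := {x | x ∈ A x.order}
  let q : Finset (Coset n) := {x | x ∈ A x.order ∪ S x.order}
  have mp : ∀ x, x ∈ p ↔ x ∈ A x.order := by simp [p]
  have mq : ∀ x, x ∈ q ↔ x ∈ A x.order ∨ x ∈ S x.order := by simp [q]
  have hw : p ∩ -qᶜ = p := by
    refine Finset.inter_eq_left.2 fun x hx => ?_
    have h := (hAS _ x.order_mem_divisors).2.2.2.1 x ((mp x).1 hx)
    rw [Finset.mem_neg', Finset.mem_compl, mq, Coset.order_neg hn]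
    tauto
  have hv : q ∩ -pᶜ = q := by
    refine Finset.inter_eq_left.2 fun x hx => ?_
    rw [Finset.mem_neg', Finset.mem_compl, mp, Coset.order_neg hn]
    intro h'
    have h := (hAS _ x.order_mem_divisors).2.2.2.1 (-x) h'
    rw [neg_neg] at h
    exact ((mq x).1 hx).elim h.1 h.2
  have hp : ∀ j ∈ n.divisors, {x ∈ p | x.order = j} = A j := by
    intro j hj
    ext x
    rw [Finset.mem_filter, mp]
    exact ⟨fun ⟨h, h'⟩ => h' ▸ h, fun h => by
      have h' := mem_level.1 ((hAS j hj).1 h)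
      exact ⟨h'.symm ▸ h, h'⟩⟩
  have hq : ∀ j ∈ n.divisors, {x ∈ q | x.order = j} = A j ∪ S j := by
    intro j hj
    ext x
    rw [Finset.mem_filter, mq, Finset.mem_union]
    refine ⟨fun ⟨h, h'⟩ => h' ▸ h, fun h => ?_⟩
    have h' : x.order = j :=
      mem_level.1 (h.elim (fun h => (hAS j hj).1 h) (fun h => (hAS j hj).2.1 h))
    exact ⟨h'.symm ▸ h, h'⟩
  refine ⟨p, q, fun x hx => (mq x).2 (.inl ((mp x).1 hx)), ?_, ?_⟩
  · rw [hw, card_residues hn, Finset.sum_filter]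
    refine Finset.sum_congr rfl fun j hj => ?_
    rw [hp j hj, (hAS j hj).2.2.2.2.1]
    split_ifs <;> simp_all
  · rw [hv, card_residues hn, Finset.sum_filter, Finset.sum_filter, Finset.sum_filter,
      ← Finset.sum_add_distrib, ← Finset.sum_add_distrib]
    refine Finset.sum_congr rfl fun j hj => ?_
    obtain ⟨-, -, hd, -, h1, h2⟩ := hAS j hj
    rw [hq j hj, Finset.card_union_of_disjoint hd, h1, h2]
    split_ifs <;> simp_all [mul_add]

end Counting

/-! ### Hulls of ideals of the quaternary group algebra -/

section QuaternaryHull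

open AddMonoidAlgebra

variable {n : ℕ} [NeZero n]

/-- The ring of vectors of length `n` over `ℤ₄` with cyclic convolution. -/
abbrev QuatAlg (n : ℕ) : Type := AddMonoidAlgebra (ZMod 4) (ZMod n)

/-- Coefficientwise reduction modulo `2`. -/
noncomputable def reduction (n : ℕ) : QuatAlg n →+* BinAlg n :=
  AddMonoidAlgebra.mapRingHom (ZMod n) (ZMod.castHom (by norm_num : 2 ∣ 4) (ZMod 2))

instance : Finite (QuatAlg n) :=
  Finite.of_injective (fun u => (u.coeff : ZMod n → ZMod 4)) fun _ _ h =>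
    AddMonoidAlgebra.ext (DFunLike.coe_injective h)

omit [NeZero n] in
theorem coeff_two_mul {R : Type*} [Semiring R] (u : AddMonoidAlgebra R (ZMod n)) (s : ZMod n) :
    (2 * u).coeff s = 2 * u.coeff s := by
  rw [two_mul, two_mul]
  rfl

theorem isResidueMap_reduction (hn : Odd n) {F : Type*} [Field F] [Algebra (ZMod 2) F]
    {ψ : AddChar (ZMod n) F} (hψ : ψ.IsPrimitive) :
    IsResidueMap (reduction n) (2 ^ n.totient) := by
  have hz : ∀ u : QuatAlg n, reduction n u = 0 ↔
      ∀ s, ZMod.castHom (by norm_num : 2 ∣ 4) (ZMod 2) (u.coeff s) = 0 := by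
    intro u
    rw [← AddMonoidAlgebra.coeff_inj, DFunLike.ext_iff]
    simp [reduction]
  refine ⟨fun u => ?_, fun u => ?_, fun u => ?_, ?_, binAlg_pow_eq hn hψ⟩
  · choose f hf using fun s =>
      ZMod.castHom_surjective (by norm_num : 2 ∣ 4) (u.coeff s)
    refine ⟨ofCoeff (Finsupp.equivFunOnFinite.symm f), ?_⟩
    ext s
    simpa [reduction] using hf s
  · rw [hz]
    constructor
    · intro h
      have key : ∀ x : ZMod 4, ZMod.castHom (by norm_num : 2 ∣ 4) (ZMod 2) x = 0 →
          ∃ y, x = 2 * y := by decide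
      choose f hf using fun s => key _ (h s)
      refine ⟨ofCoeff (Finsupp.equivFunOnFinite.symm f), ?_⟩
      ext s
      rw [coeff_two_mul]
      simpa using hf s
    · rintro ⟨t, rfl⟩ s
      rw [coeff_two_mul, map_mul, map_ofNat]
      exact zero_mul _
  · rw [hz, ← AddMonoidAlgebra.coeff_inj, DFunLike.ext_iff]
    refine forall_congr' fun s => ?_
    rw [coeff_two_mul]
    have key : ∀ x : ZMod 4, 2 * x = 0 ↔
        ZMod.castHom (by norm_num : 2 ∣ 4) (ZMod 2) x = 0 := by decide
    exact key _
  · exact Nat.le_self_pow (Nat.totient_pos.2 hn.pos).ne' 2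

omit [NeZero n] in
theorem reduction_reversal (u : QuatAlg n) :
    reduction n (reversal (ZMod 4) n u) = reversal (ZMod 2) n (reduction n u) := by
  ext s
  simp [reduction, reversal]

theorem exists_isPrimitive (hn : Odd n) :
    ∃ ψ : AddChar (ZMod n) (AlgebraicClosure (ZMod 2)), ψ.IsPrimitive := by
  have : NeZero (n : AlgebraicClosure (ZMod 2)) := by
    refine ⟨fun h => ?_⟩
    rw [CharP.cast_eq_zero_iff _ 2] at h
    exact Nat.not_even_iff_odd.2 hn (even_iff_two_dvd.2 h)
  obtain ⟨ζ, hζ⟩ :=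
    HasEnoughRootsOfUnity.exists_primitiveRoot (AlgebraicClosure (ZMod 2)) n
  exact ⟨_, AddChar.zmodChar_primitive_of_primitive_root n hζ⟩

theorem card_idealHull (hn : Odd n) {F : Type*} [Field F] [Algebra (ZMod 2) F]
    {ψ : AddChar (ZMod n) F} (hψ : ψ.IsPrimitive) {D : Ideal (QuatAlg n)}
    {p q : Finset (Coset n)} (hp : D.map (reduction n) = cosetIdeal ψ p)
    (hq : torsionIdeal (reduction n) D = cosetIdeal ψ q) {k₁ k₂ : ℕ}
    (h₁ : (residues (p ∩ -qᶜ)).card = k₁) (h₂ : (residues (q ∩ -pᶜ)).card = k₁ + k₂) :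
    Nat.card (idealHull (reversal (ZMod 4) n) D) = 2 ^ (2 * k₁ + k₂) ∧
      Nat.card {x : idealHull (reversal (ZMod 4) n) D // 2 • x = 0} = 2 ^ (k₁ + k₂) := by
  have hπ := isResidueMap_reduction hn hψ
  have hσ := reduction_reversal (n := n)
  rw [hπ.card_ideal, hπ.card_two_torsion, hπ.map_idealHull hσ, hπ.torsionIdeal_idealHull hσ, hp, hq,
    annihilator_cosetIdeal hn hψ, annihilator_cosetIdeal hn hψ, comap_reversal_cosetIdeal,
    comap_reversal_cosetIdeal, cosetIdeal_inf, cosetIdeal_inf, card_cosetIdeal hn hψ,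
    card_cosetIdeal hn hψ, h₁, h₂, ← pow_add]
  exact ⟨by ring_nf, rfl⟩

theorem exists_isAdmissible_card_idealHull (hn : Odd n) (D : Ideal (QuatAlg n)) :
    ∃ k₁ k₂, IsAdmissible n k₁ k₂ ∧
      Nat.card (idealHull (reversal (ZMod 4) n) D) = 2 ^ (2 * k₁ + k₂) ∧
      Nat.card {x : idealHull (reversal (ZMod 4) n) D // 2 • x = 0} = 2 ^ (k₁ + k₂) := by
  obtain ⟨ψ, hψ⟩ := exists_isPrimitive hn
  obtain ⟨p, hp⟩ := exists_eq_cosetIdeal hn hψ (D.map (reduction n))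
  obtain ⟨q, hq⟩ := exists_eq_cosetIdeal hn hψ (torsionIdeal (reduction n) D)
  have hle := (isResidueMap_reduction hn hψ).map_le_torsionIdeal D
  rw [hp, hq] at hle
  obtain ⟨k₁, k₂, h, h₁, h₂⟩ := isAdmissible_of_subset hn (subset_of_cosetIdeal_le hn hψ hle)
  exact ⟨k₁, k₂, h, card_idealHull hn hψ hp hq h₁ h₂⟩

theorem IsAdmissible.exists_ideal (hn : Odd n) {k₁ k₂ : ℕ} (h : IsAdmissible n k₁ k₂) :
    ∃ D : Ideal (QuatAlg n),
      Nat.card (idealHull (reversal (ZMod 4) n) D) = 2 ^ (2 * k₁ + k₂) ∧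
      Nat.card {x : idealHull (reversal (ZMod 4) n) D // 2 • x = 0} = 2 ^ (k₁ + k₂) := by
  obtain ⟨ψ, hψ⟩ := exists_isPrimitive hn
  obtain ⟨p, q, hpq, h₁, h₂⟩ := h.exists_subset hn
  obtain ⟨D, hp, hq⟩ := (isResidueMap_reduction hn hψ).exists_ideal
    (cosetIdeal_isPrincipal hn hψ p) (cosetIdeal_mono hpq)
  exact ⟨D, card_idealHull hn hψ hp hq h₁ h₂⟩

end QuaternaryHull

/-! ### Splitting codes over `Z4v` into two ideals -/

section Components

open AddMonoidAlgebra QuadraticAlgebra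

/-- The two ring homomorphisms `Z4v → ℤ₄`, sending `v` to `0` and to `1`. -/
def component : Fin 2 → Z4v →+* ZMod 4 :=
  ![{ toFun := fun z => z.re
      map_one' := rfl
      map_zero' := rfl
      map_add' := fun _ _ => rfl
      map_mul' := fun x y => by simp },
    { toFun := fun z => z.re + z.im
      map_one' := rfl
      map_zero' := rfl
      map_add' := fun x y => by simp only [re_add, im_add]; ring
      map_mul' := fun x y => by simp only [re_mul, im_mul]; ring }]

theorem exists_component_eq (f : Fin 2 → ZMod 4) : ∃ z : Z4v, ∀ i, component i z = f i := by
  refine ⟨⟨f 0, f 1 - f 0⟩, fun i => ?_⟩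
  fin_cases i
  · rfl
  · exact add_sub_cancel _ _

theorem component_ext {x y : Z4v} (h : ∀ i, component i x = component i y) : x = y := by
  have h0 : x.re = y.re := h 0
  have h1 : x.re + x.im = y.re + y.im := h 1
  rw [h0] at h1
  exact QuadraticAlgebra.ext h0 (add_left_cancel h1)

variable {n : ℕ} [NeZero n]

/-- A component of a vector over `Z4v`, as an element of the group algebra. -/
noncomputable def vecComponent (i : Fin 2) : (Fin n → Z4v) →+ QuatAlg n where
  toFun c := ofCoeff (Finsupp.equivFunOnFinite.symm fun s =>
    component i (c ((ZMod.finEquiv n).symm s)))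
  map_zero' := by ext s; simp
  map_add' x y := by ext s; simp

theorem coeff_vecComponent (i : Fin 2) (c : Fin n → Z4v) (s : ZMod n) :
    (vecComponent i c).coeff s = component i (c ((ZMod.finEquiv n).symm s)) := rfl

theorem exists_vecComponent_eq (f : Fin 2 → QuatAlg n) :
    ∃ c : Fin n → Z4v, ∀ i, vecComponent i c = f i := by
  choose c hc using fun s : Fin n =>
    exists_component_eq fun i => (f i).coeff (ZMod.finEquiv n s)
  refine ⟨c, fun i => ?_⟩
  ext s
  rw [coeff_vecComponent, hc, RingEquiv.apply_symm_apply]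

theorem vecComponent_ext {x y : Fin n → Z4v} (h : ∀ i, vecComponent i x = vecComponent i y) :
    x = y := by
  funext s
  refine component_ext fun i => ?_
  have := congrArg (fun u => u.coeff (ZMod.finEquiv n s)) (h i)
  simpa [coeff_vecComponent] using this

theorem vecComponent_cyclicShift (i : Fin 2) (c : Fin n → Z4v) :
    vecComponent i (cyclicShift c) = single 1 1 * vecComponent i c := by
  ext s
  rw [coeff_single_mul_apply, coeff_vecComponent, coeff_vecComponent, one_mul, cyclicShift,
    finRotate_symm_apply, neg_add_eq_sub, map_sub, map_one]

theorem vecComponent_smul (i : Fin 2) (r : Z4v) (c : Fin n → Z4v) :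
    vecComponent i (r • c) = single 0 (component i r) * vecComponent i c := by
  ext s
  rw [coeff_single_mul_apply, coeff_vecComponent, coeff_vecComponent, neg_zero, zero_add,
    Pi.smul_apply, smul_eq_mul, map_mul]

/-- This is how the inner product of vectors enters the convolution algebra. -/
theorem coeff_reversal_mul (u v : QuatAlg n) :
    (reversal (ZMod 4) n u * v).coeff 0 = ∑ s, u.coeff s * v.coeff s := by
  rw [coeff_mul_apply_left, Finsupp.sum_fintype _ _ (by simp), ← Equiv.sum_comp (Equiv.neg _)]
  simp [reversal]

theorem coeff_reversal_vecComponent_mul (i : Fin 2) (h k : Fin n → Z4v) :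
    (reversal (ZMod 4) n (vecComponent i h) * vecComponent i k).coeff 0 =
      component i (∑ s, h s * k s) := by
  rw [coeff_reversal_mul, map_sum, ← Equiv.sum_comp (ZMod.finEquiv n).toEquiv]
  simp [coeff_vecComponent]

/-- The component of a cyclic code, as an ideal of the group algebra. -/
noncomputable def codeComponent (C : LinearCode n) (hC : IsCyclicCode C) (i : Fin 2) :
    Ideal (QuatAlg n) where
  carrier := {u | ∃ c ∈ C, vecComponent i c = u}
  zero_mem' := ⟨0, C.zero_mem, map_zero _⟩
  add_mem' := by
    rintro _ _ ⟨c, hc, rfl⟩ ⟨d, hd, rfl⟩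
    exact ⟨c + d, C.add_mem hc hd, map_add _ _ _⟩
  smul_mem' := by
    have hshift : ∀ (k : ℕ), ∀ c ∈ C, ∃ d ∈ C,
        vecComponent i d = single (1 : ZMod n) 1 ^ k * vecComponent i c := by
      intro k c hc
      induction k with
      | zero => exact ⟨c, hc, by simp⟩
      | succ k ih =>
        obtain ⟨d, hd, h⟩ := ih
        exact ⟨_, hC d hd, by rw [vecComponent_cyclicShift, h, pow_succ', mul_assoc]⟩
    rintro u _ ⟨c, hc, rfl⟩
    induction u using AddMonoidAlgebra.induction_linear with
    | zero => exact ⟨0, C.zero_mem, by simp⟩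
    | add x y hx hy =>
      obtain ⟨a, ha, ha'⟩ := hx
      obtain ⟨b, hb, hb'⟩ := hy
      exact ⟨a + b, C.add_mem ha hb, by rw [map_add, ha', hb', add_smul]⟩
    | single m r =>
      obtain ⟨d, hd, h⟩ := hshift m.val c hc
      obtain ⟨z, hz⟩ := exists_component_eq fun _ => r
      refine ⟨z • d, C.smul_mem z hd, ?_⟩
      rw [vecComponent_smul, hz, h, ← mul_assoc, single_pow, single_mul_single, smul_eq_mul]
      simp

theorem mem_codeComponent {C : LinearCode n} {hC : IsCyclicCode C} {i : Fin 2} {u : QuatAlg n} :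
    u ∈ codeComponent C hC i ↔ ∃ c ∈ C, vecComponent i c = u := Iff.rfl

theorem mem_iff_vecComponent {C : LinearCode n} (hC : IsCyclicCode C) {c : Fin n → Z4v} :
    c ∈ C ↔ ∀ i, vecComponent i c ∈ codeComponent C hC i := by
  refine ⟨fun h i => ⟨c, h, rfl⟩, fun h => ?_⟩
  choose d hd hd' using h
  -- The orthogonal idempotents of `Z4v` glue codewords chosen separately for each component.
  choose e he using fun j : Fin 2 => exists_component_eq fun i => if i = j then 1 else 0
  have hc : c = ∑ j, e j • d j := by
    refine vecComponent_ext fun i => ?_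
    rw [map_sum, Finset.sum_eq_single i]
    · rw [vecComponent_smul, he, if_pos rfl, hd', ← one_def, one_mul]
    · intro j _ hj
      rw [vecComponent_smul, he, if_neg hj.symm, single_zero, zero_mul]
    · simp
  rw [hc]
  exact C.sum_mem fun j _ => C.smul_mem _ (hd j)

theorem mem_dual_iff_vecComponent {C : LinearCode n} (hC : IsCyclicCode C) {h : Fin n → Z4v} :
    h ∈ dual C ↔
      ∀ i, ∀ u ∈ codeComponent C hC i, reversal (ZMod 4) n (vecComponent i h) * u = 0 := by
  constructor
  · intro hh i u hu
    have key : ∀ u ∈ codeComponent C hC i,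
        (reversal (ZMod 4) n (vecComponent i h) * u).coeff 0 = 0 := by
      rintro _ ⟨c, hc, rfl⟩
      rw [coeff_reversal_vecComponent_mul, hh c hc, map_zero]
    ext s
    -- Orthogonality only controls the coefficient at 0; shifting `u` by `-s` moves the coefficient
    -- at `s` there.
    have h1 := key _ ((codeComponent C hC i).mul_mem_left (single (-s) 1) hu)
    rw [mul_left_comm, coeff_single_mul_apply] at h1
    simpa using h1
  · intro hh c hc
    refine component_ext fun i => ?_
    rw [← coeff_reversal_vecComponent_mul, hh i _ ⟨c, hc, rfl⟩]
    exact (map_zero (component i)).symm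

theorem mem_hull_iff_vecComponent {C : LinearCode n} (hC : IsCyclicCode C) {c : Fin n → Z4v} :
    c ∈ hull C ↔
      ∀ i, vecComponent i c ∈ idealHull (reversal (ZMod 4) n) (codeComponent C hC i) := by
  rw [hull, Submodule.mem_inf, mem_iff_vecComponent hC, mem_dual_iff_vecComponent hC]
  simp only [mem_idealHull, forall_and]

/-- The hull of a cyclic code is the product of the hulls of its components. -/
theorem nonempty_hull_addEquiv {C : LinearCode n} (hC : IsCyclicCode C) :
    Nonempty (hull C ≃+ idealHull (reversal (ZMod 4) n) (codeComponent C hC 0) ×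
      idealHull (reversal (ZMod 4) n) (codeComponent C hC 1)) := by
  have hmem := fun (c : hull C) => (mem_hull_iff_vecComponent hC).1 c.2
  let f : hull C →+ idealHull (reversal (ZMod 4) n) (codeComponent C hC 0) ×
      idealHull (reversal (ZMod 4) n) (codeComponent C hC 1) :=
    { toFun := fun c => (⟨vecComponent 0 c.1, hmem c 0⟩, ⟨vecComponent 1 c.1, hmem c 1⟩)
      map_zero' := by ext1 <;> exact Subtype.ext (map_zero _)
      map_add' := fun x y => by ext1 <;> exact Subtype.ext (map_add _ _ _) }
  refine ⟨AddEquiv.ofBijective f ⟨fun x y hxy => ?_, fun ⟨u, w⟩ => ?_⟩⟩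
  · refine Subtype.ext (vecComponent_ext (Fin.forall_fin_two.2 ⟨?_, ?_⟩))
    · exact congrArg (fun z => z.1.1) hxy
    · exact congrArg (fun z => z.2.1) hxy
  · obtain ⟨c, hc⟩ := exists_vecComponent_eq ![u.1, w.1]
    have h0 : vecComponent 0 c = u.1 := hc 0
    have h1 : vecComponent 1 c = w.1 := hc 1
    refine ⟨⟨c, (mem_hull_iff_vecComponent hC).2 (Fin.forall_fin_two.2 ⟨?_, ?_⟩)⟩, ?_⟩
    · rw [h0]
      exact u.2
    · rw [h1]
      exact w.2
    · exact Prod.ext (Subtype.ext h0) (Subtype.ext h1)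

/-- Every pair of ideals of the group algebra consists of the components of a cyclic code. -/
theorem exists_codeComponent_eq (I : Fin 2 → Ideal (QuatAlg n)) :
    ∃ (C : LinearCode n) (hC : IsCyclicCode C), ∀ i, codeComponent C hC i = I i := by
  let C : LinearCode n :=
    { carrier := {c | ∀ i, vecComponent i c ∈ I i}
      zero_mem' := fun i => by rw [map_zero]; exact (I i).zero_mem
      add_mem' := fun hx hy i => by rw [map_add]; exact (I i).add_mem (hx i) (hy i)
      smul_mem' := fun r x hx i => by
        rw [vecComponent_smul]
        exact (I i).mul_mem_left _ (hx i) }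
  have hC : IsCyclicCode C := fun c hc i => by
    rw [vecComponent_cyclicShift]
    exact (I i).mul_mem_left _ (hc i)
  refine ⟨C, hC, fun i => ?_⟩
  ext u
  rw [mem_codeComponent]
  constructor
  · rintro ⟨c, hc, rfl⟩
    exact hc i
  · intro hu
    obtain ⟨c, hc⟩ := exists_vecComponent_eq fun j => if j = i then u else 0
    refine ⟨c, fun j => ?_, by rw [hc, if_pos rfl]⟩
    rw [hc]
    split_ifs with h
    · rw [h]
      exact hu
    · exact (I j).zero_mem

theorem four_nsmul_eq_zero {M : Type*} [AddCommGroup M] [Module Z4v M] (x : M) : 4 • x = 0 := by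
  have h : ((4 : ℕ) : Z4v) = 0 := by decide
  rw [← Nat.cast_smul_eq_nsmul Z4v, h, zero_smul]

/-- Orders and 2-torsion orders multiply over the two components, and their exponents `2k₁ + k₂` and
`k₁ + k₂` determine the type. -/
theorem hasType_hull_iff {C : LinearCode n} (hC : IsCyclicCode C) {k₁ k₂ : Fin 2 → ℕ}
    (h : ∀ i, Nat.card (idealHull (reversal (ZMod 4) n) (codeComponent C hC i)) =
        2 ^ (2 * k₁ i + k₂ i) ∧
      Nat.card {x : idealHull (reversal (ZMod 4) n) (codeComponent C hC i) // 2 • x = 0} =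
        2 ^ (k₁ i + k₂ i)) (l₁ l₂ : ℕ) :
    HasType (hull C) l₁ l₂ ↔ l₁ = k₁ 0 + k₁ 1 ∧ l₂ = k₂ 0 + k₂ 1 := by
  obtain ⟨f⟩ := nonempty_hull_addEquiv hC
  have : Finite (hull C) := Finite.of_equiv _ f.symm.toEquiv
  rw [HasType, nonempty_addEquiv_iff four_nsmul_eq_zero, card_two_torsion_congr f,
    card_two_torsion_prod, Nat.card_congr f.toEquiv, Nat.card_prod, (h 0).1, (h 0).2, (h 1).1,
    (h 1).2, ← pow_add, ← pow_add, Nat.pow_right_inj one_lt_two, Nat.pow_right_inj one_lt_two]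
  omega

end Components

end HullTypes

/-! ### The types of hulls over `Z4v` -/

theorem theorem4p2 (n : ℕ) (hn : Odd n) :
    (∀ C : HullTypes.LinearCode n, HullTypes.IsCyclicCode C →
      ∃ k₁ k₂ : ℕ, HullTypes.HasType (HullTypes.hull C) k₁ k₂) ∧
    ∀ k₁ k₂ : ℕ,
      (∃ C : HullTypes.LinearCode n, HullTypes.IsCyclicCode C ∧
        HullTypes.HasType (HullTypes.hull C) k₁ k₂) ↔
      ∃ a b c : Fin 2 → ℕ → ℕ,
        (∀ i, ∀ j ∈ n.divisors, j ∈ HullTypes.N₂ → b i j ≤ HullTypes.γ j) ∧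
        (∀ i, ∀ j ∈ n.divisors, j ∉ HullTypes.N₂ →
          a i j ≤ HullTypes.β j ∧ c i j ≤ 2 * (HullTypes.β j - a i j)) ∧
        k₁ = ∑ j ∈ n.divisors with j ∉ HullTypes.N₂, HullTypes.ord j * (a 0 j + a 1 j) ∧
        k₂ = ∑ j ∈ n.divisors with j ∈ HullTypes.N₂, HullTypes.ord j * (b 0 j + b 1 j) +
          ∑ j ∈ n.divisors with j ∉ HullTypes.N₂, HullTypes.ord j * (c 0 j + c 1 j) := by
  have : NeZero n := ⟨hn.pos.ne'⟩
  refine ⟨fun C hC => ?_, fun l₁ l₂ => ⟨?_, ?_⟩⟩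
  · choose k₁ k₂ _ hk using fun i =>
      HullTypes.exists_isAdmissible_card_idealHull hn (HullTypes.codeComponent C hC i)
    exact ⟨_, _, (HullTypes.hasType_hull_iff hC hk _ _).2 ⟨rfl, rfl⟩⟩
  · rintro ⟨C, hC, hl⟩
    choose k₁ k₂ hadm hk using fun i =>
      HullTypes.exists_isAdmissible_card_idealHull hn (HullTypes.codeComponent C hC i)
    obtain ⟨rfl, rfl⟩ := (HullTypes.hasType_hull_iff hC hk _ _).1 hl
    choose a b c hb hac h₁ h₂ using hadm
    refine ⟨a, b, c, hb, hac, ?_, ?_⟩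
    · simp only [mul_add, Finset.sum_add_distrib, ← h₁]
    · rw [h₂, h₂]
      simp only [mul_add, Finset.sum_add_distrib]
      ring
  · rintro ⟨a, b, c, hb, hac, rfl, rfl⟩
    choose I hI using fun i : Fin 2 => HullTypes.IsAdmissible.exists_ideal hn
      ⟨a i, b i, c i, hb i, hac i, rfl, rfl⟩
    obtain ⟨C, hC, hCI⟩ := HullTypes.exists_codeComponent_eq I
    refine ⟨C, hC, (HullTypes.hasType_hull_iff hC (fun i => by rw [hCI]; exact hI i) _ _).2
      ⟨?_, ?_⟩⟩
    · simp only [mul_add, Finset.sum_add_distrib]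
    · simp only [mul_add, Finset.sum_add_distrib]
      ring
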